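/- For coprime integers $a,b$ with $b>0$, let \[ S(a,b)=12\sum_{k=1}^{b}\left(\!\!\left(\tfrac{k}{b}\right)\!\!\right)\left(\!\!\left(\tfrac{ak}{b}\right)\!\!\right) \] be the normalized Dedekind sum, where $((x))=\{x\}-\tfrac12$ if $x\notin\mathbb{Z}$ and $((x))=0$ if $x\in\mathbb{Z}$. For an integer $q\ge 2$, let $\Lambda_q\subseteq\mathbb{Z}/(q^2-1)\mathbb{Z}$ be the set of residues modulo $q^2-1$ of the numbers (which are integers) \[ \frac{(q^2-1)a}{t}-qS(aq,t), \] where $a,t$ range over the integers with $t>0$, $t\mid a^2+1$ and $\gcd(aq,t)=1$. Let $\Gamma_q\subseteq\mathbb{Z}/(q^2-1)\mathbb{Z}$ be the set $\{24s : s\in\mathbb{Z}/(q^2-1)\mathbb{Z}\}$ if $q$ is a square, and $\{12s : s\in\mathbb{Z}/(q^2-1)\mathbb{Z}\}$ otherwise. Theorem. Let $q\ge 2$ be an integer with $\Lambda_q=\Gamma_q$. Then for every integer $k$ with $\gcd(k,q)=1$, there exist integers $a,b$ with $b\ge1$, $\gcd(a,b)=1$ and $S(a,b)=\frac{k}{q}$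 if and only if both of the following conditions hold: - if $3\nmid q$, then $3\mid k$; - if $2\nmid q$, then $k\equiv 2\pmod 4$ when $q\equiv 3\pmod 4$; $k\equiv 0\pmod 8$ when $q$ is a square; and $k\equiv 0\pmod 4$ in all other cases. -/

import Mathlib

/-- The sawtooth function `((x))`: it is `{x} - 1/2` off the integers and `0` on the integers. -/
noncomputable def sawtooth (x : ℝ) : ℝ :=
  open Classical in if ∃ n : ℤ, (n : ℝ) = x then 0 else Int.fract x - 1 / 2

/-- The Dedekind sum `s(a,b) = ∑_{k=1}^{b} ((k/b)) ((ak/b))`. -/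
noncomputable def dedekindSum (a b : ℤ) : ℝ :=
  ∑ k ∈ Finset.Icc (1 : ℤ) b, sawtooth ((k : ℝ) / b) * sawtooth ((a * k : ℝ) / b)

/-- The normalized Dedekind sum `S(a,b) = 12 s(a,b)`. -/
noncomputable def normDedekindSum (a b : ℤ) : ℝ :=
  12 * dedekindSum a b

/-- The set `Λ_q ⊆ ℤ/(q²-1)ℤ` of the residues of the numbers `(q²-1)a/t - q S(aq,t)`, for integers
`a`, `t` with `t > 0`, `t ∣ a² + 1` and `gcd(aq,t) = 1`. These numbers are in fact integers;
`n` below is that integer. -/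
def LambdaSet (q : ℕ) : Set (ZMod (q ^ 2 - 1)) :=
  {x | ∃ a t n : ℤ, 0 < t ∧ t ∣ a ^ 2 + 1 ∧ Int.gcd (a * q) t = 1 ∧
    (n : ℝ) = ((q : ℝ) ^ 2 - 1) * a / t - q * normDedekindSum (a * q) t ∧
    x = (n : ZMod (q ^ 2 - 1))}

/-- The set `Γ_q ⊆ ℤ/(q²-1)ℤ`: the multiples of `24` if `q` is a square, and the multiples of `12`
otherwise. -/
def GammaSet (q : ℕ) : Set (ZMod (q ^ 2 - 1)) :=
  {x | (IsSquare q → ∃ s : ZMod (q ^ 2 - 1), x = 24 * s) ∧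
    (¬ IsSquare q → ∃ s : ZMod (q ^ 2 - 1), x = 12 * s)}

/-- Girstmair's local conditions on the numerator `k` of a normalized Dedekind sum with reduced
denominator `q`. -/
def LocalConditions (q : ℕ) (k : ℤ) : Prop :=
  (¬ 3 ∣ q → 3 ∣ k) ∧
  (¬ 2 ∣ q →
    (q ≡ 3 [MOD 4] → k ≡ 2 [ZMOD 4]) ∧
    (IsSquare q → k ≡ 0 [ZMOD 8]) ∧
    (¬ q ≡ 3 [MOD 4] → ¬ IsSquare q → k ≡ 0 [ZMOD 4]))

/-! Put A = q S(k,q), an integer. The theorem joins two facts that do not depend on the hypothesis: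
k/q is a value of S iff k - A lies in Λ_q (`exists_normDedekindSum_eq_iff`), and k - A lies in Γ_q
iff the local conditions hold (`mem_GammaSet_iff_localConditions`).

The first fact rests on the Rademacher function Φ. By reciprocity, Φ is a homomorphism on SL(2, ℤ)
up to 3 times a sign. If X has upper right entry divisible by q and Y is its conjugate by diag(q⁻¹,
1), then X and Y carry the same sign terms, so Φ(Y) - Φ(X) is exactly additive. Evaluated on a
suitable product of three matrices, this gives `normDedekindSum_mul_eq_add`: with md ≡ -1 mod q, a
certain q S(w', qt') equals λ + d(1 - q²) + q S(m,q), where λ has the form defining Λ_q. The other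
Dedekind sums drop out because S(w,t) = 0 when t ∣ w² + 1. Taking m = k gives one direction;
inverting the parametrization gives the other.

The second fact needs A only modulo 3 and 8: 3 ∣ A if 3 ∤ q, and A ≡ q + 1 - 2(k/q) mod 8 for odd q,
with the Jacobi symbol (k/q). Modulo q² - 1, the multiples of 12 or 24 are those of gcd(12, q² - 1)
or gcd(24, q² - 1). -/

/-! ### Elementary properties of the sawtooth function and of S -/

theorem sawtooth_intCast_div {b : ℕ} (hb : 0 < b) (n : ℤ) :
    sawtooth ((n : ℝ) / b) = if (b : ℤ) ∣ n then 0 else ((n % b : ℤ) : ℝ) / b - 1 / 2 := by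
  have hb' : (b : ℝ) ≠ 0 := by positivity
  unfold sawtooth
  by_cases h : (b : ℤ) ∣ n
  · rw [if_pos h, if_pos]
    obtain ⟨c, rfl⟩ := h
    exact ⟨c, by push_cast; field_simp⟩
  · rw [if_neg h, if_neg]
    · congr 1
      rw [Int.fract_eq_iff]
      refine ⟨?_, ?_, n / b, ?_⟩
      · have := Int.emod_nonneg n (b := b) (by omega)
        have : (0 : ℝ) ≤ ((n % b : ℤ) : ℝ) := by exact_mod_cast this
        positivity
      · have := Int.emod_lt_of_pos n (b := b) (by omega)
        have : ((n % b : ℤ) : ℝ) < b := by exact_mod_cast this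
        rw [div_lt_one (by positivity)]
        exact this
      · have h1 : ((n % b : ℤ) : ℝ) = n - b * ((n / b : ℤ) : ℝ) := by
          have := Int.emod_add_mul_ediv n b
          have h2 : ((n % b : ℤ) : ℝ) + b * ((n / b : ℤ) : ℝ) = n := by exact_mod_cast this
          linarith
        rw [h1]
        field_simp
        ring
    · rintro ⟨c, hc⟩
      apply h
      refine ⟨c, ?_⟩
      rw [eq_div_iff hb'] at hc
      have : (n : ℝ) = ((b * c : ℤ) : ℝ) := by push_cast; linarith
      exact_mod_cast this

theorem sawtooth_add_intCast (x : ℝ) (n : ℤ) : sawtooth (x + n) = sawtooth x := by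
  unfold sawtooth
  have : (∃ m : ℤ, (m : ℝ) = x + n) ↔ ∃ m : ℤ, (m : ℝ) = x :=
    ⟨fun ⟨m, h⟩ => ⟨m - n, by push_cast; linarith⟩, fun ⟨m, h⟩ => ⟨m + n, by push_cast; linarith⟩⟩
  by_cases h : ∃ m : ℤ, (m : ℝ) = x
  · rw [if_pos h, if_pos (this.mpr h)]
  · rw [if_neg h, if_neg (fun h' => h (this.mp h')), Int.fract_add_intCast]

theorem sawtooth_neg (x : ℝ) : sawtooth (-x) = -sawtooth x := by
  unfold sawtooth
  have : (∃ m : ℤ, (m : ℝ) = -x) ↔ ∃ m : ℤ, (m : ℝ) = x :=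
    ⟨fun ⟨m, h⟩ => ⟨-m, by push_cast; linarith⟩, fun ⟨m, h⟩ => ⟨-m, by push_cast; linarith⟩⟩
  by_cases h : ∃ m : ℤ, (m : ℝ) = x
  · rw [if_pos h, if_pos (this.mpr h), neg_zero]
  · rw [if_neg h, if_neg (fun h' => h (this.mp h'))]
    have hf : Int.fract x ≠ 0 := by
      intro h0
      rw [Int.fract_eq_zero_iff] at h0
      obtain ⟨m, hm⟩ := h0
      exact h ⟨m, hm⟩
    rw [Int.fract_neg hf]
    ring

theorem normDedekindSum_neg (a b : ℤ) : normDedekindSum (-a) b = -normDedekindSum a b := by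
  unfold normDedekindSum dedekindSum
  rw [← mul_neg, ← Finset.sum_neg_distrib]
  congr 1
  refine Finset.sum_congr rfl fun k _ => ?_
  rw [← mul_neg, ← sawtooth_neg]
  push_cast
  congr 2
  ring

theorem normDedekindSum_add_mul (a b c : ℤ) (hb : b ≠ 0) :
    normDedekindSum (a + b * c) b = normDedekindSum a b := by
  unfold normDedekindSum dedekindSum
  congr 1
  refine Finset.sum_congr rfl fun k _ => ?_
  have hb' : (b : ℝ) ≠ 0 := by exact_mod_cast hb
  rw [← sawtooth_add_intCast ((a : ℝ) * k / b) (c * k)]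
  congr 2
  push_cast
  field_simp

theorem normDedekindSum_congr {a a' b : ℤ} (hb : b ≠ 0) (h : b ∣ a' - a) :
    normDedekindSum a b = normDedekindSum a' b := by
  obtain ⟨c, hc⟩ := h
  rw [← normDedekindSum_add_mul a b c hb, ← hc]
  congr 1
  ring

theorem normDedekindSum_one (a : ℤ) : normDedekindSum a 1 = 0 := by
  unfold normDedekindSum dedekindSum
  have : sawtooth (1 : ℝ) = 0 := by
    unfold sawtooth
    exact if_pos ⟨1, by simp⟩
  simp [this]

/-! ### Finite sums, the reciprocity law and integrality -/

theorem sum_Icc_int_eq_sum_range (b : ℕ) (f : ℤ → ℝ) (h0 : f 0 = f b) :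
    ∑ k ∈ Finset.Icc (1 : ℤ) b, f k = ∑ i ∈ Finset.range b, f i := by
  have h1 : ∑ k ∈ Finset.Icc (1 : ℤ) b, f k = ∑ i ∈ Finset.range b, f ((i + 1 : ℕ) : ℤ) := by
    refine Finset.sum_nbij' (fun k => (k - 1).toNat) (fun i => ((i + 1 : ℕ) : ℤ)) ?_ ?_ ?_ ?_ ?_
    · intro k hk; simp only [Finset.mem_Icc, Finset.mem_range] at *; omega
    · intro k hk; simp only [Finset.mem_Icc, Finset.mem_range] at *; omega
    · intro k hk; simp only [Finset.mem_Icc] at *; omega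
    · intro k hk; simp
    · intro k hk
      simp only [Finset.mem_Icc] at *
      congr 1; omega
  have h2 := Finset.sum_range_succ (fun i : ℕ => f i) b
  rw [Finset.sum_range_succ'] at h2
  rw [h1]
  simp only [Nat.cast_zero] at h2
  linarith

theorem sum_range_mul_mod {M : Type*} [AddCommMonoid M] {a b : ℕ} (h : a.Coprime b) (g : ℕ → M) :
    ∑ i ∈ Finset.range b, g (a * i % b) = ∑ i ∈ Finset.range b, g i := by
  rcases Nat.eq_zero_or_pos b with rfl | hb
  · simp
  have hinj : Set.InjOn (fun i => a * i % b) (Finset.range b : Set ℕ) := by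
    intro i hi j hj hij
    simp only [Finset.coe_range, Set.mem_Iio] at hi hj
    have h1 : a * i ≡ a * j [MOD b] := hij
    have h2 : i ≡ j [MOD b] := Nat.ModEq.cancel_left_of_coprime (by rwa [Nat.gcd_comm]) h1
    exact Nat.ModEq.eq_of_lt_of_lt h2 hi hj
  have himg : (Finset.range b).image (fun i => a * i % b) = Finset.range b := by
    apply Finset.eq_of_subset_of_card_le
    · intro x hx
      simp only [Finset.mem_image, Finset.mem_range] at *
      obtain ⟨i, _, rfl⟩ := hx
      exact Nat.mod_lt _ hb
    · rw [Finset.card_image_of_injOn hinj]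
  conv_rhs => rw [← himg, Finset.sum_image hinj]

theorem sum_range_cast (b : ℕ) : ∑ i ∈ Finset.range b, (i : ℝ) = b * (b - 1) / 2 := by
  induction b with
  | zero => simp
  | succ n ih => rw [Finset.sum_range_succ, ih]; push_cast; ring

theorem sum_range_sq_cast (b : ℕ) :
    ∑ i ∈ Finset.range b, (i : ℝ) ^ 2 = (b - 1) * b * (2 * b - 1) / 6 := by
  induction b with
  | zero => simp
  | succ n ih => rw [Finset.sum_range_succ, ih]; push_cast; ring

theorem normDedekindSum_eq_sum_mod {a b : ℕ} (hb : 0 < b) (h : a.Coprime b) :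
    normDedekindSum a b * b ^ 2
      = 12 * ∑ i ∈ Finset.range b, (i : ℝ) * (a * i % b : ℕ) - 3 * b ^ 2 * (b - 1) := by
  have hb' : (b : ℝ) ≠ 0 := by positivity
  have hz : ∀ k : ℤ, (b : ℤ) ∣ k → sawtooth ((k : ℝ) / b) = 0 := fun k hk => by
    rw [sawtooth_intCast_div hb, if_pos hk]
  have h1 : dedekindSum a b = ∑ i ∈ Finset.range b,
      sawtooth (((i : ℤ) : ℝ) / b) * sawtooth (((a : ℤ) * (i : ℤ) : ℝ) / b) := by
    unfold dedekindSum
    refine sum_Icc_int_eq_sum_range b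
      (fun k => sawtooth ((k : ℝ) / b) * sawtooth (((a : ℤ) * k : ℝ) / b)) ?_
    rw [hz 0 (by simp), hz b (by simp)]
    simp
  -- The last term corrects i = 0, where the polynomial formula gives (-1/2)² instead of 0.
  have h2 : ∀ i ∈ Finset.range b,
      sawtooth (((i : ℤ) : ℝ) / b) * sawtooth (((a : ℤ) * (i : ℤ) : ℝ) / b)
      = (1 / b ^ 2) * ((i : ℝ) * (a * i % b : ℕ)) - (1 / (2 * b)) * (i : ℝ)
        - (1 / (2 * b)) * ((a * i % b : ℕ) : ℝ) + 1 / 4 - (if i = 0 then 1 / 4 else 0) := by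
    intro i hi
    rw [Finset.mem_range] at hi
    rcases Nat.eq_zero_or_pos i with rfl | hi0
    · rw [hz _ (by simp)]
      simp
    · have hn1 : ¬ (b : ℤ) ∣ (i : ℤ) := by
        rw [Int.natCast_dvd_natCast]
        exact fun hd => absurd (Nat.le_of_dvd hi0 hd) (by omega)
      have hn2 : ¬ (b : ℤ) ∣ ((a : ℤ) * i) := by
        rw [← Nat.cast_mul, Int.natCast_dvd_natCast]
        intro hd
        have := (Nat.Coprime.dvd_of_dvd_mul_left h.symm hd)
        exact absurd (Nat.le_of_dvd hi0 this) (by omega)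
      have e2 : (((a : ℤ) : ℝ) * ((i : ℤ) : ℝ) / b) = (((a : ℤ) * i : ℤ) : ℝ) / b := by push_cast; rfl
      rw [e2, sawtooth_intCast_div hb, sawtooth_intCast_div hb, if_neg hn1, if_neg hn2,
        if_neg (by omega)]
      have e3 : ((i : ℤ) % (b : ℤ)) = ((i : ℕ) : ℤ) := by
        rw [← Int.natCast_mod, Nat.mod_eq_of_lt hi]
      have e4 : ((a : ℤ) * i % (b : ℤ)) = ((a * i % b : ℕ) : ℤ) := by push_cast; rfl
      rw [e3, e4]
      generalize a * i % b = r
      push_cast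
      field_simp
      ring
  have h3 := sum_range_mul_mod h (fun i => (i : ℝ))
  unfold normDedekindSum
  rw [h1, Finset.sum_congr rfl h2, Finset.sum_sub_distrib, Finset.sum_add_distrib,
    Finset.sum_sub_distrib, Finset.sum_sub_distrib, ← Finset.mul_sum, ← Finset.mul_sum,
    ← Finset.mul_sum, h3, sum_range_cast, Finset.sum_ite_eq' (Finset.range b) 0,
    if_pos (Finset.mem_range.mpr hb), Finset.sum_const, Finset.card_range, nsmul_eq_mul]
  field_simp
  ring

theorem normDedekindSum_eq_sum_div {a b : ℕ} (hb : 0 < b) (h : a.Coprime b) :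
    normDedekindSum a b * b
      = 2 * a * (b - 1) * (2 * b - 1) - 12 * ∑ i ∈ Finset.range b, (i : ℝ) * (a * i / b : ℕ)
        - 3 * b * (b - 1) := by
  have hb' : (b : ℝ) ≠ 0 := by positivity
  have h1 := normDedekindSum_eq_sum_mod hb h
  have h2 : ∑ i ∈ Finset.range b, (i : ℝ) * (a * i % b : ℕ)
      = a * ∑ i ∈ Finset.range b, (i : ℝ) ^ 2 - b * ∑ i ∈ Finset.range b, (i : ℝ) * (a * i / b : ℕ) := by
    rw [Finset.mul_sum, Finset.mul_sum, ← Finset.sum_sub_distrib]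
    refine Finset.sum_congr rfl fun i _ => ?_
    have : ((a * i % b : ℕ) : ℝ) + b * (a * i / b : ℕ) = a * i := by
      exact_mod_cast Nat.mod_add_div (a * i) b
    rw [← sub_eq_iff_eq_add.mpr this.symm]
    ring
  rw [h2, sum_range_sq_cast] at h1
  apply mul_right_cancel₀ hb'
  linear_combination h1

/-- Lattice points under the line y = ax/b: f(f + 1) is twice the sum of all j ≤ f, and the double
sum is then taken in the other order. Coprimality keeps points with 0 < j < a off the line, so
exactly b - 1 - ⌊bj/a⌋ values of i remain for each such j. -/
theorem sum_range_floor_mul_succ {a b : ℕ} (ha : 0 < a) (hb : 0 < b) (h : a.Coprime b) :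
    ∑ i ∈ Finset.range b, (((a * i / b : ℕ) : ℝ) * ((a * i / b : ℕ) + 1))
      = 2 * ∑ j ∈ Finset.range a, (j : ℝ) * (b - 1 - (b * j / a : ℕ)) := by
  have h1 : ∀ i ∈ Finset.range b, (((a * i / b : ℕ) : ℝ) * ((a * i / b : ℕ) + 1))
      = 2 * ∑ j ∈ Finset.range a, if j ≤ a * i / b then (j : ℝ) else 0 := by
    intro i hi
    rw [Finset.mem_range] at hi
    have hlt : a * i / b < a := by
      rw [Nat.div_lt_iff_lt_mul hb]
      exact Nat.mul_lt_mul_of_pos_left hi ha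
    rw [← Finset.sum_filter]
    have : (Finset.range a).filter (fun j => j ≤ a * i / b) = Finset.range (a * i / b + 1) := by
      ext j; simp only [Finset.mem_filter, Finset.mem_range]; omega
    rw [this, sum_range_cast]
    push_cast
    ring
  have h2 : ∀ j ∈ Finset.range a, ∑ i ∈ Finset.range b, (if j ≤ a * i / b then (j : ℝ) else 0)
      = (j : ℝ) * (b - 1 - (b * j / a : ℕ)) := by
    intro j hj
    rw [Finset.mem_range] at hj
    rcases Nat.eq_zero_or_pos j with rfl | hj0
    · simp
    rw [← Finset.sum_filter, Finset.sum_const, nsmul_eq_mul, mul_comm]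
    have hlt : b * j / a < b := by
      rw [Nat.div_lt_iff_lt_mul ha]
      exact Nat.mul_lt_mul_of_pos_left hj hb
    have : (Finset.range b).filter (fun i => j ≤ a * i / b) = Finset.Ico (b * j / a + 1) b := by
      ext i
      simp only [Finset.mem_filter, Finset.mem_range, Finset.mem_Ico, Nat.succ_le_iff]
      rw [Nat.le_div_iff_mul_le hb, Nat.div_lt_iff_lt_mul ha]
      constructor
      · rintro ⟨h1, h2⟩
        refine ⟨lt_of_le_of_ne (by linarith) ?_, h1⟩
        intro heq
        have : a ∣ j := h.dvd_of_dvd_mul_left ⟨i, by rw [heq]; ring⟩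
        exact absurd (Nat.le_of_dvd hj0 this) (by omega)
      · rintro ⟨h1, h2⟩
        exact ⟨h2, by linarith⟩
    rw [this, Nat.card_Ico, Nat.cast_sub (by omega)]
    push_cast
    ring
  rw [Finset.sum_congr rfl h1, ← Finset.mul_sum, Finset.sum_comm, Finset.sum_congr rfl h2]

/-- The reciprocity law of Dedekind sums. -/
theorem normDedekindSum_reciprocity {a b : ℕ} (ha : 0 < a) (hb : 0 < b) (h : a.Coprime b) :
    normDedekindSum a b * (a * b) + normDedekindSum b a * (a * b)
      = a ^ 2 + b ^ 2 + 1 - 3 * a * b := by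
  have hb' : (b : ℝ) ≠ 0 := by positivity
  have e1 := normDedekindSum_eq_sum_div hb h
  have e2 := normDedekindSum_eq_sum_div ha h.symm
  have e3 := sum_range_floor_mul_succ ha hb h
  -- The residues r = ai - b⌊ai/b⌋ permute 0, …, b - 1, so Σ r and Σ r² are known. Expanding both
  -- yields `f4` and `f5`, and the lattice count `f3` eliminates the sum of squared floors.
  have e4 := sum_range_mul_mod h (fun i => (i : ℝ))
  have e5 := sum_range_mul_mod h (fun i => (i : ℝ) ^ 2)
  have hr : ∀ i, ((a * i % b : ℕ) : ℝ) = a * i - b * (a * i / b : ℕ) := by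
    intro i
    have : ((a * i % b : ℕ) : ℝ) + b * (a * i / b : ℕ) = a * i := by
      exact_mod_cast Nat.mod_add_div (a * i) b
    linarith
  set P := ∑ i ∈ Finset.range b, (i : ℝ) * (a * i / b : ℕ) with hP
  set Q := ∑ i ∈ Finset.range a, (i : ℝ) * (b * i / a : ℕ) with hQ
  have f4 : a * ∑ i ∈ Finset.range b, (i : ℝ) - b * ∑ i ∈ Finset.range b, ((a * i / b : ℕ) : ℝ)
      = ∑ i ∈ Finset.range b, (i : ℝ) := by
    refine Eq.trans ?_ e4
    rw [Finset.sum_congr rfl fun i _ => hr i, Finset.sum_sub_distrib, ← Finset.mul_sum,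
      ← Finset.mul_sum]
  have f5 : a ^ 2 * ∑ i ∈ Finset.range b, (i : ℝ) ^ 2 - 2 * a * b * P
      + b ^ 2 * ∑ i ∈ Finset.range b, ((a * i / b : ℕ) : ℝ) ^ 2
      = ∑ i ∈ Finset.range b, (i : ℝ) ^ 2 := by
    refine Eq.trans ?_ e5
    rw [hP, Finset.mul_sum, Finset.mul_sum, Finset.mul_sum, ← Finset.sum_sub_distrib,
      ← Finset.sum_add_distrib]
    refine Finset.sum_congr rfl fun i _ => ?_
    rw [hr]
    ring
  have f3 : ∑ i ∈ Finset.range b, ((a * i / b : ℕ) : ℝ) ^ 2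
      + ∑ i ∈ Finset.range b, ((a * i / b : ℕ) : ℝ)
      = 2 * ((b - 1) * ∑ i ∈ Finset.range a, (i : ℝ) - Q) := by
    rw [hQ, Finset.mul_sum, ← Finset.sum_sub_distrib, ← Finset.sum_add_distrib]
    refine Eq.trans (Finset.sum_congr rfl fun i _ => ?_) (e3.trans ?_)
    · ring
    · congr 1
      refine Finset.sum_congr rfl fun i _ => ?_
      ring
  rw [sum_range_cast] at f3 f4
  rw [sum_range_sq_cast] at f5
  apply mul_right_cancel₀ hb'
  linear_combination (a * b : ℝ) * e1 + (b * b : ℝ) * e2 + 6 * f5 - 6 * b ^ 2 * f3 - 6 * b * f4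

/-- `b S(a,b)` is an integer. -/
theorem exists_int_eq_mul_normDedekindSum {a b : ℤ} (hb : 0 < b) (h : Int.gcd a b = 1) :
    ∃ n : ℤ, (n : ℝ) = b * normDedekindSum a b ∧ (¬ 3 ∣ b → 3 ∣ n) := by
  lift b to ℕ using hb.le
  obtain ⟨c, hc⟩ := Int.eq_ofNat_of_zero_le (Int.emod_nonneg a hb.ne')
  have hcop : c.Coprime b := by
    have h1 : Int.gcd (a % b) b = 1 := by rwa [Int.gcd_emod]
    rw [hc] at h1
    exact_mod_cast h1
  have hS : normDedekindSum a b = normDedekindSum c b := by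
    apply normDedekindSum_congr hb.ne'
    have h1 : (c : ℤ) = a % b := hc.symm
    rw [h1]
    exact ⟨-(a / b), by linarith [Int.emod_add_mul_ediv a b]⟩
  have hb0 : 0 < b := by exact_mod_cast hb
  rw [hS]
  set n : ℤ := 2 * c * (b - 1) * (2 * b - 1)
    - 12 * ∑ i ∈ Finset.range b, (i : ℤ) * (c * i / b : ℕ) - 3 * b * (b - 1) with hn
  have hnr : (n : ℝ) = ((b : ℕ) : ℤ) * normDedekindSum c b := by
    have e := normDedekindSum_eq_sum_div hb0 hcop
    rw [mul_comm, Int.cast_natCast, e, hn]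
    push_cast
    rfl
  refine ⟨n, hnr, fun h3 => ?_⟩
  -- The remainder form shows that 3 divides nb.
  have e := normDedekindSum_eq_sum_mod hb0 hcop
  have e' : (n * b : ℤ) = 3 * (4 * ∑ i ∈ Finset.range b, (i : ℤ) * (c * i % b : ℕ)
      - b ^ 2 * (b - 1)) := by
    have : ((n * b : ℤ) : ℝ) = ((3 * (4 * ∑ i ∈ Finset.range b, (i : ℤ) * (c * i % b : ℕ)
      - b ^ 2 * (b - 1)) : ℤ) : ℝ) := by
      rw [Int.cast_mul, hnr]
      simp only [Int.cast_mul, Int.cast_sub, Int.cast_sum, Int.cast_natCast, Int.cast_ofNat,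
        Int.cast_pow, Int.cast_one] at e ⊢
      linear_combination e
    exact_mod_cast this
  have hd : (3 : ℤ) ∣ n * b := ⟨_, e'⟩
  exact (Int.prime_three.dvd_or_dvd hd).resolve_right h3

/-! ### The Rademacher function and its composition law -/

open Matrix Matrix.SpecialLinearGroup ModularGroup

/-- The Rademacher function on `SL(2, ℤ)`. -/
noncomputable def rademacherPhi (M : SpecialLinearGroup (Fin 2) ℤ) : ℝ :=
  if M 1 0 = 0 then (M 0 1 : ℝ) / M 1 1
  else ((M 0 0 : ℝ) + M 1 1) / M 1 0 - (M 1 0).sign * normDedekindSum (M 1 1) |M 1 0|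

theorem normDedekindSum_reciprocity_int {c d : ℤ} (hc : c ≠ 0) (hd : d ≠ 0)
    (h : IsCoprime c d) :
    (d.sign : ℝ) * normDedekindSum c |d| + c.sign * normDedekindSum d |c|
      = (c ^ 2 + d ^ 2 + 1) / (c * d) - 3 * (c * d).sign := by
  have key : ∀ c d : ℤ, 0 < c → 0 < d → IsCoprime c d →
      normDedekindSum c d + normDedekindSum d c = (c ^ 2 + d ^ 2 + 1) / (c * d) - 3 := by
    intro c d hc hd h
    lift c to ℕ using hc.le
    lift d to ℕ using hd.le
    have hc' : 0 < c := by exact_mod_cast hc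
    have hd' : 0 < d := by exact_mod_cast hd
    have := normDedekindSum_reciprocity hc' hd' (Nat.isCoprime_iff_coprime.mp h)
    have h1 : (c : ℝ) ≠ 0 := by positivity
    have h2 : (d : ℝ) ≠ 0 := by positivity
    push_cast
    rw [div_sub' (by positivity), eq_div_iff (by positivity)]
    linear_combination this
  rcases lt_or_gt_of_ne hc with hc' | hc' <;> rcases lt_or_gt_of_ne hd with hd' | hd'
  · have := key (-c) (-d) (by omega) (by omega) (h.neg_neg)
    rw [Int.sign_mul, Int.sign_eq_neg_one_of_neg hc', Int.sign_eq_neg_one_of_neg hd',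
      abs_of_neg hc', abs_of_neg hd']
    rw [normDedekindSum_neg, normDedekindSum_neg] at this
    push_cast at this ⊢
    rw [neg_mul_neg] at this
    linear_combination this
  · have := key (-c) d (by omega) (by omega) (h.neg_left)
    rw [Int.sign_mul, Int.sign_eq_neg_one_of_neg hc', Int.sign_eq_one_of_pos hd',
      abs_of_neg hc', abs_of_pos hd']
    rw [normDedekindSum_neg] at this
    push_cast at this ⊢
    rw [neg_mul, div_neg] at this
    linear_combination -this
  · have := key c (-d) (by omega) (by omega) (h.neg_right)
    rw [Int.sign_mul, Int.sign_eq_neg_one_of_neg hd', Int.sign_eq_one_of_pos hc',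
      abs_of_neg hd', abs_of_pos hc']
    rw [normDedekindSum_neg] at this
    push_cast at this ⊢
    rw [mul_neg, div_neg] at this
    linear_combination -this
  · have := key c d hc' hd' h
    rw [Int.sign_mul, Int.sign_eq_one_of_pos hd', Int.sign_eq_one_of_pos hc',
      abs_of_pos hd', abs_of_pos hc']
    push_cast
    linear_combination this

theorem SL2_det (M : SpecialLinearGroup (Fin 2) ℤ) : M 0 0 * M 1 1 - M 0 1 * M 1 0 = 1 := by
  have := M.det_coe
  rwa [Matrix.det_fin_two] at this

theorem SL2_row_one_isCoprime (M : SpecialLinearGroup (Fin 2) ℤ) : IsCoprime (M 1 0) (M 1 1) :=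
  ⟨-M 0 1, M 0 0, by linear_combination SL2_det M⟩

theorem rademacherPhi_mul_T_zpow (M : SpecialLinearGroup (Fin 2) ℤ) (n : ℤ) :
    rademacherPhi (M * T ^ n) = rademacherPhi M + n := by
  have h : ∀ i, (M * T ^ n) i 0 = M i 0 ∧ (M * T ^ n) i 1 = M i 0 * n + M i 1 := by
    intro i
    simp [coe_T_zpow, Matrix.mul_apply, Fin.sum_univ_two]
  have hdet := SL2_det M
  unfold rademacherPhi
  rw [(h 1).1, (h 1).2, (h 0).1, (h 0).2]
  split_ifs with hc
  · rw [hc] at hdet ⊢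
    have h1 : M 0 0 = M 1 1 := by
      rcases Int.eq_one_or_neg_one_of_mul_eq_one' (u := M 0 0) (v := M 1 1) (by linarith) with h | h
      · rw [h.1, h.2]
      · rw [h.1, h.2]
    have h2 : (M 1 1 : ℝ) ≠ 0 := by
      intro h0
      have : M 1 1 = 0 := by exact_mod_cast h0
      rw [this] at hdet
      simp at hdet
    rw [h1]
    push_cast
    rw [zero_mul, zero_add, add_div, mul_div_cancel_left₀ _ h2]
    ring
  · have h2 : (M 1 0 : ℝ) ≠ 0 := by exact_mod_cast hc
    rw [normDedekindSum_congr (a := M 1 0 * n + M 1 1) (a' := M 1 1) (abs_ne_zero.mpr hc)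
      ((abs_dvd _ _).mpr ⟨-n, by ring⟩)]
    push_cast
    field_simp
    ring

/-- Reciprocity in matrix form: right multiplication by `S` turns the lower row (c, d) into (d, -c).
-/
theorem rademacherPhi_mul_S (M : SpecialLinearGroup (Fin 2) ℤ) :
    rademacherPhi (M * S) = rademacherPhi M - 3 * (M 1 0 * M 1 1).sign := by
  have h : ∀ i, (M * S) i 0 = M i 1 ∧ (M * S) i 1 = -M i 0 := by
    intro i
    simp [coe_S, Matrix.mul_apply, Fin.sum_univ_two]
  have hdet := SL2_det M
  have hdetr : (M 0 0 * M 1 1 - M 0 1 * M 1 0 : ℝ) = 1 := by exact_mod_cast hdet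
  unfold rademacherPhi
  rw [(h 1).1, (h 1).2, (h 0).1, (h 0).2]
  have hone : ∀ c : ℤ, c = 1 ∨ c = -1 → ∀ a, normDedekindSum a |c| = 0 := by
    rintro c (rfl | rfl) a <;> simp [normDedekindSum_one]
  by_cases hc : M 1 0 = 0 <;> by_cases hd : M 1 1 = 0
  · rw [hc, hd] at hdet; simp at hdet
  · rw [if_neg hd, if_pos hc, hc]
    have hu : M 1 1 = 1 ∨ M 1 1 = -1 := by
      rw [hc] at hdet
      exact Int.isUnit_iff.mp (IsUnit.of_mul_eq_one (M 0 0) (by linarith))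
    rw [hone _ hu]
    simp
  · rw [if_pos hd, if_neg hc, hd]
    have hu : M 1 0 = 1 ∨ M 1 0 = -1 := by
      rw [hd] at hdet
      exact Int.isUnit_iff.mp (IsUnit.of_mul_eq_one (-M 0 1) (by linarith))
    rw [hone _ hu]
    rcases hu with h | h <;> simp [h, div_neg]
  · rw [if_neg hd, if_neg hc]
    have := normDedekindSum_reciprocity_int hc hd (SL2_row_one_isCoprime M)
    rw [normDedekindSum_neg]
    have h1 : (M 1 0 : ℝ) ≠ 0 := by exact_mod_cast hc
    have h2 : (M 1 1 : ℝ) ≠ 0 := by exact_mod_cast hd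
    have e : ((M 0 1 : ℝ) + (-M 1 0 : ℤ)) / M 1 1 - (M 0 0 + M 1 1) / M 1 0
        = -((M 1 0 ^ 2 + M 1 1 ^ 2 + 1) / (M 1 0 * M 1 1)) := by
      push_cast
      field_simp
      linear_combination -hdetr
    linear_combination e + this

/-- Let D = xv - yu. If xv and yu have the same nonzero sign, then ux and vy agree in sign, as do xy
and uv, so D does not matter. Otherwise the sign of D is determined by those of the variables and
each pattern is checked. -/
theorem sign_cocycle {x y u v : ℤ} (hxy : x ≠ 0 ∨ y ≠ 0) (huv : u ≠ 0 ∨ v ≠ 0) :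
    ((x * v - y * u) * u * x).sign + (x * y).sign
      = ((x * v - y * u) * v * y).sign + (u * v).sign := by
  have tri : ∀ z : ℤ, (z.sign = -1 ∧ z < 0) ∨ (z.sign = 0 ∧ z = 0) ∨ (z.sign = 1 ∧ 0 < z) := by
    intro z
    rcases lt_trichotomy z 0 with h | h | h
    · exact Or.inl ⟨Int.sign_eq_neg_one_of_neg h, h⟩
    · exact Or.inr (Or.inl ⟨by rw [h]; rfl, h⟩)
    · exact Or.inr (Or.inr ⟨Int.sign_eq_one_of_pos h, h⟩)
  simp only [Int.sign_mul]
  rcases tri x with ⟨sx, hx⟩ | ⟨sx, hx⟩ | ⟨sx, hx⟩ <;>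
  rcases tri y with ⟨sy, hy⟩ | ⟨sy, hy⟩ | ⟨sy, hy⟩ <;>
  rcases tri u with ⟨su, hu⟩ | ⟨su, hu⟩ | ⟨su, hu⟩ <;>
  rcases tri v with ⟨sv, hv⟩ | ⟨sv, hv⟩ | ⟨sv, hv⟩ <;>
  rw [sx, sy, su, sv] <;>
  first
  | omega
  | (rcases tri (x * v - y * u) with ⟨sc, hc⟩ | ⟨sc, hc⟩ | ⟨sc, hc⟩ <;> rw [sc] <;>
      first
      | rfl
      | (exfalso
         first
         | (rw [hx] at hc; nlinarith)
         | (rw [hy] at hc; nlinarith)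
         | (rw [hu] at hc; nlinarith)
         | (rw [hv] at hc; nlinarith)
         | nlinarith))

/-- The composition law of the Rademacher function. -/
theorem rademacherPhi_mul (M N : SpecialLinearGroup (Fin 2) ℤ) :
    rademacherPhi (M * N) = rademacherPhi M + rademacherPhi N
      - 3 * (M 1 0 * N 1 0 * (M * N) 1 0).sign := by
  have hS : ∀ N : SpecialLinearGroup (Fin 2) ℤ,
      (∀ M : SpecialLinearGroup (Fin 2) ℤ, rademacherPhi (M * N) = rademacherPhi M + rademacherPhi N
        - 3 * (M 1 0 * N 1 0 * (M * N) 1 0).sign) →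
      ∀ M : SpecialLinearGroup (Fin 2) ℤ,
        rademacherPhi (M * (N * S)) = rademacherPhi M + rademacherPhi (N * S)
        - 3 * (M 1 0 * (N * S) 1 0 * (M * (N * S)) 1 0).sign := by
    intro N ih M
    rw [← mul_assoc, rademacherPhi_mul_S, rademacherPhi_mul_S, ih M]
    have h : ∀ A : SpecialLinearGroup (Fin 2) ℤ, (A * S) 1 0 = A 1 1 := by
      intro A
      simp [coe_S, Matrix.mul_apply, Fin.sum_univ_two]
    rw [h, h]
    have hne : ∀ A : SpecialLinearGroup (Fin 2) ℤ, A 1 0 ≠ 0 ∨ A 1 1 ≠ 0 := by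
      intro A
      by_contra! hh
      have := SL2_det A
      rw [hh.1, hh.2] at this
      simp at this
    -- Taken for the lower rows of `M * N` and `N`, the determinant in the cocycle is `M 1 0`.
    have e := sign_cocycle (hne (M * N)) (hne N)
    have hc : (M * N) 1 0 * N 1 1 - (M * N) 1 1 * N 1 0 = M 1 0 := by
      have := SL2_det N
      simp only [coe_mul, Matrix.mul_apply, Fin.sum_univ_two]
      linear_combination M 1 0 * this
    rw [hc] at e
    have e' : (((M 1 0 * N 1 0 * (M * N) 1 0).sign : ℤ) : ℝ) + ((M * N) 1 0 * (M * N) 1 1).sign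
      = ((M 1 0 * N 1 1 * (M * N) 1 1).sign : ℤ) + (N 1 0 * N 1 1).sign := by exact_mod_cast e
    linear_combination -3 * e'
  have hT : ∀ (N : SpecialLinearGroup (Fin 2) ℤ) (n : ℤ),
      (∀ M : SpecialLinearGroup (Fin 2) ℤ, rademacherPhi (M * N) = rademacherPhi M + rademacherPhi N
        - 3 * (M 1 0 * N 1 0 * (M * N) 1 0).sign) →
      ∀ M : SpecialLinearGroup (Fin 2) ℤ,
        rademacherPhi (M * (N * T ^ n)) = rademacherPhi M + rademacherPhi (N * T ^ n)
        - 3 * (M 1 0 * (N * T ^ n) 1 0 * (M * (N * T ^ n)) 1 0).sign := by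
    intro N n ih M
    have h : ∀ A : SpecialLinearGroup (Fin 2) ℤ, (A * T ^ n) 1 0 = A 1 0 := by
      intro A
      simp [coe_T_zpow, Matrix.mul_apply, Fin.sum_univ_two]
    rw [← mul_assoc, rademacherPhi_mul_T_zpow, rademacherPhi_mul_T_zpow, ih M, h, h]
    ring
  -- The law, for all `M` at once, survives right multiplication of `N` by generators, so it follows
  -- by induction on words.
  have hmem : N ∈ Subgroup.closure {S, T} := by
    rw [SpecialLinearGroup.SL2Z_generators]
    exact Subgroup.mem_top N
  revert M
  induction hmem using Subgroup.closure_induction_right with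
  | one => intro M; simp [rademacherPhi]
  | mul_right N _ y hy ih =>
    rcases hy with rfl | rfl
    · exact hS N ih
    · simpa using hT N 1 ih
  | mul_inv_cancel N _ y hy ih =>
    rcases hy with rfl | rfl
    · have hinv : (S⁻¹ : SpecialLinearGroup (Fin 2) ℤ) = S * S * S := by
        ext i j
        fin_cases i <;> fin_cases j <;> simp [coe_S, Matrix.mul_apply, Fin.sum_univ_two]
      rw [hinv, ← mul_assoc, ← mul_assoc]
      exact hS _ (hS _ (hS N ih))
    · simpa using hT N (-1) ih

theorem rademacherPhi_inv (M : SpecialLinearGroup (Fin 2) ℤ) :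
    rademacherPhi M⁻¹ = -rademacherPhi M := by
  have h := rademacherPhi_mul M M⁻¹
  have h1 : rademacherPhi 1 = 0 := by simp [rademacherPhi]
  rw [mul_inv_cancel, h1] at h
  simp at h
  linarith

/-- Inverting a matrix swaps its diagonal entries and negates Φ. -/
theorem normDedekindSum_eq_of_mul_modEq_one {a d c : ℤ} (hc : 0 < c) (h : c ∣ a * d - 1) :
    normDedekindSum a c = normDedekindSum d c := by
  obtain ⟨b, hb⟩ := h
  let M : SpecialLinearGroup (Fin 2) ℤ := ⟨!![a, b; c, d], by
    rw [Matrix.det_fin_two_of]; linarith⟩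
  have e00 : M 0 0 = a := rfl
  have e10 : M 1 0 = c := rfl
  have e11 : M 1 1 = d := rfl
  have h1 := rademacherPhi_inv M
  have i00 : M⁻¹ 0 0 = M 1 1 := by rw [SL2_inv_expl]; rfl
  have i10 : M⁻¹ 1 0 = -M 1 0 := by rw [SL2_inv_expl]; rfl
  have i11 : M⁻¹ 1 1 = M 0 0 := by rw [SL2_inv_expl]; rfl
  unfold rademacherPhi at h1
  rw [i00, i10, i11, e00, e10, e11, if_neg (by omega), if_neg hc.ne', abs_neg, Int.sign_neg,
    Int.sign_eq_one_of_pos hc, abs_of_pos hc] at h1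
  push_cast at h1
  rw [div_neg, add_comm (d : ℝ)] at h1
  linarith

/-- Here -w is the inverse of w modulo t, while S is odd in its first argument. -/
theorem normDedekindSum_eq_zero_of_dvd_sq_add_one {w t : ℤ} (ht : 0 < t) (h : t ∣ w ^ 2 + 1) :
    normDedekindSum w t = 0 := by
  have := normDedekindSum_eq_of_mul_modEq_one (a := w) (d := -w) ht
    (by obtain ⟨n, hn⟩ := h; exact ⟨-n, by linarith⟩)
  rw [normDedekindSum_neg] at this
  linarith

/-! ### Conjugate pairs and the key identity -/

/-- `Y` is the conjugate of `X` by the diagonal matrix with entries `q⁻¹, 1`. -/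
def IsDiagConj (q : ℤ) (X Y : SpecialLinearGroup (Fin 2) ℤ) : Prop :=
  Y 0 0 = X 0 0 ∧ X 0 1 = q * Y 0 1 ∧ Y 1 0 = q * X 1 0 ∧ Y 1 1 = X 1 1

theorem IsDiagConj.mul {q : ℤ} {X X' Y Y' : SpecialLinearGroup (Fin 2) ℤ}
    (hX : IsDiagConj q X X') (hY : IsDiagConj q Y Y') : IsDiagConj q (X * Y) (X' * Y') := by
  obtain ⟨a1, a2, a3, a4⟩ := hX
  obtain ⟨b1, b2, b3, b4⟩ := hY
  unfold IsDiagConj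
  simp only [coe_mul, Matrix.mul_apply, Fin.sum_univ_two]
  rw [a1, a2, a3, a4, b1, b2, b3, b4]
  refine ⟨?_, ?_, ?_, ?_⟩ <;> ring

theorem IsDiagConj.inv {q : ℤ} {X X' : SpecialLinearGroup (Fin 2) ℤ}
    (hX : IsDiagConj q X X') : IsDiagConj q X⁻¹ X'⁻¹ := by
  obtain ⟨a1, a2, a3, a4⟩ := hX
  rw [SL2_inv_expl X, SL2_inv_expl X']
  refine ⟨a4, ?_, ?_, a1⟩
  · change -X 0 1 = q * -X' 0 1
    rw [a2]; ring
  · change -X' 1 0 = q * -X 1 0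
    rw [a3]; ring

/-- `Φ(Y) - Φ(X)` is additive on pairs `(X, Y)` of conjugates. -/
theorem IsDiagConj.rademacherPhi_mul_sub {q : ℤ} (hq : 0 < q)
    {X X' Y Y' : SpecialLinearGroup (Fin 2) ℤ}
    (hX : IsDiagConj q X X') (hY : IsDiagConj q Y Y') :
    rademacherPhi (X' * Y') - rademacherPhi (X * Y)
      = (rademacherPhi X' - rademacherPhi X) + (rademacherPhi Y' - rademacherPhi Y) := by
  have h := (hX.mul hY).2.2.1
  rw [rademacherPhi_mul, rademacherPhi_mul, h, hX.2.2.1, hY.2.2.1]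
  simp only [Int.sign_mul, Int.sign_eq_one_of_pos hq, one_mul]
  ring

theorem rademacherPhi_of_pos {M : SpecialLinearGroup (Fin 2) ℤ} (h : 0 < M 1 0) :
    rademacherPhi M = ((M 0 0 : ℝ) + M 1 1) / M 1 0 - normDedekindSum (M 1 1) (M 1 0) := by
  rw [rademacherPhi, if_neg h.ne', Int.sign_eq_one_of_pos h, abs_of_pos h]
  simp

theorem rademacherPhi_S : rademacherPhi S = 0 := by
  have h1 : S 1 0 = 1 := by simp [coe_S]
  have h2 : S 0 0 = 0 := by simp [coe_S]
  have h3 : S 1 1 = 0 := by simp [coe_S]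
  rw [rademacherPhi_of_pos (by rw [h1]; exact one_pos), h1, h2, h3, normDedekindSum_one]
  simp

theorem rademacherPhi_S_mul_T_zpow_mul_S (n : ℤ) :
    rademacherPhi (S * T ^ n * S) = n - 3 * n.sign := by
  rw [rademacherPhi_mul_S, rademacherPhi_mul_T_zpow, rademacherPhi_S]
  have h1 : (S * T ^ n) 1 0 = 1 := by
    simp [coe_S, coe_T_zpow]
  have h2 : (S * T ^ n) 1 1 = n := by
    simp [coe_S, coe_T_zpow]
  rw [h1, h2]
  simp

/-- Additivity of Φ(Y) - Φ(X) is applied to the product A B H⁻¹, chosen so that the Dedekind sum on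
the unconjugated side vanishes and the one on the conjugated side has denominator qt'. -/
theorem normDedekindSum_mul_eq_add {q : ℤ} (hq : 0 < q) {v t n m d l : ℤ} (ht : 0 < t)
    (htn : t * n = (q * v) ^ 2 + 1) (hl : q * l = -m * d - 1) :
    0 < n - 2 * d * (q * v) + d ^ 2 * t ∧
    IsCoprime (q * (n - 2 * d * (q * v) + d ^ 2 * t))
      (d * t - q * v + m * (n - 2 * d * (q * v) + d ^ 2 * t)) ∧
    q * normDedekindSum (d * t - q * v + m * (n - 2 * d * (q * v) + d ^ 2 * t))
        (q * (n - 2 * d * (q * v) + d ^ 2 * t))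
      = (((q : ℝ) ^ 2 - 1) * (q * v) / t - q * normDedekindSum (q * v * q) t)
        + d * (1 - q ^ 2) - q * normDedekindSum d q := by
  obtain ⟨t', ht'⟩ : ∃ t', t' = n - 2 * d * (q * v) + d ^ 2 * t := ⟨_, rfl⟩
  obtain ⟨w', hw'⟩ : ∃ w', w' = d * t - q * v + m * t' := ⟨_, rfl⟩
  rw [← ht', ← hw']
  have htt' : t * t' = (q * v - d * t) ^ 2 + 1 := by rw [ht']; linear_combination htn
  have ht'pos : 0 < t' := by
    have : 0 < t * t' := by rw [htt']; positivity
    exact (mul_pos_iff_of_pos_left ht).mp this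
  have hqr : (q : ℝ) ≠ 0 := by exact_mod_cast hq.ne'
  have htr : (t : ℝ) ≠ 0 := by exact_mod_cast ht.ne'
  have ht'r : (t' : ℝ) ≠ 0 := by exact_mod_cast ht'pos.ne'
  let A : SpecialLinearGroup (Fin 2) ℤ := S * T ^ d * S
  let A' : SpecialLinearGroup (Fin 2) ℤ := S * T ^ (q * d) * S
  let B : SpecialLinearGroup (Fin 2) ℤ :=
    ⟨!![t, q * v; q * v, n], by rw [det_fin_two_of]; linarith⟩
  let B' : SpecialLinearGroup (Fin 2) ℤ :=
    ⟨!![t, v; q * (q * v), n], by rw [det_fin_two_of]; linarith⟩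
  let H : SpecialLinearGroup (Fin 2) ℤ :=
    ⟨!![-m, q * l; 1, d], by rw [det_fin_two_of]; linarith⟩
  let H' : SpecialLinearGroup (Fin 2) ℤ :=
    ⟨!![-m, l; q, d], by rw [det_fin_two_of]; linarith⟩
  have hA : (A : Matrix (Fin 2) (Fin 2) ℤ) = !![-1, 0; d, -1] := by
    simp [A, coe_S, coe_T_zpow]
  have hA' : (A' : Matrix (Fin 2) (Fin 2) ℤ) = !![-1, 0; q * d, -1] := by
    simp [A', coe_S, coe_T_zpow]
  have cA : IsDiagConj q A A' := by
    unfold IsDiagConj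
    rw [hA, hA']
    simp
  have cB : IsDiagConj q B B' := ⟨rfl, rfl, rfl, rfl⟩
  have cH : IsDiagConj q H H' := ⟨rfl, rfl, (mul_one q).symm, rfl⟩
  have e1 := cA.rademacherPhi_mul_sub hq (cB.mul cH.inv)
  have e2 := cB.rademacherPhi_mul_sub hq cH.inv
  have cF := cA.mul (cB.mul cH.inv)
  have hF : ((A * (B * H⁻¹) : SpecialLinearGroup (Fin 2) ℤ) : Matrix (Fin 2) (Fin 2) ℤ)
      = !![q * v - t * d, t * (q * l) + q * v * m; t', w'] := by
    have hHi : ((H⁻¹ : SpecialLinearGroup (Fin 2) ℤ) : Matrix (Fin 2) (Fin 2) ℤ)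
        = !![d, -(q * l); -1, -m] := by rw [SL2_inv_expl]; rfl
    rw [coe_mul A, coe_mul B, hA, hHi]
    change !![-1, 0; d, -1] * (!![t, q * v; q * v, n] * !![d, -(q * l); -1, -m]) = _
    rw [hw', ht']
    ext i j
    fin_cases i <;> fin_cases j <;> simp [Matrix.mul_apply, Fin.sum_univ_two]
    · ring
    · ring
    · ring
    · linear_combination (q * v - d * t) * hl
  have f00 : (A * (B * H⁻¹)) 0 0 = q * v - t * d := by rw [hF]; rfl
  have f10 : (A * (B * H⁻¹)) 1 0 = t' := by rw [hF]; rfl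
  have f11 : (A * (B * H⁻¹)) 1 1 = w' := by rw [hF]; rfl
  -- The trace is mt', and t' divides w'² + 1, so only m remains.
  have phiF : rademacherPhi (A * (B * H⁻¹)) = m := by
    rw [rademacherPhi_of_pos (by rw [f10]; exact ht'pos), f00, f10, f11,
      normDedekindSum_eq_zero_of_dvd_sq_add_one ht'pos, hw']
    · push_cast
      field_simp
      ring
    · refine ⟨t + 2 * (d * t - q * v) * m + m ^ 2 * t', ?_⟩
      rw [hw']
      linear_combination -htt'
  obtain ⟨g1, -, g3, g4⟩ := cF
  have phiF' : rademacherPhi (A' * (B' * H'⁻¹)) = m / q - normDedekindSum w' (q * t') := by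
    rw [rademacherPhi_of_pos (by rw [g3, f10]; positivity), g1, g3, g4, f00, f10, f11]
    congr 1
    rw [hw']
    push_cast
    field_simp
    ring
  have phiA : rademacherPhi A' - rademacherPhi A = d * q - d := by
    simp only [A, A', rademacherPhi_S_mul_T_zpow_mul_S, Int.sign_mul, Int.sign_eq_one_of_pos hq,
      one_mul]
    push_cast
    ring
  have phiH : rademacherPhi H = d - m := by
    rw [rademacherPhi_of_pos (M := H) one_pos]
    change ((-m : ℤ) + (d : ℤ) : ℝ) / (1 : ℤ) - normDedekindSum d 1 = _
    rw [normDedekindSum_one]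
    push_cast
    ring
  have phiH' : rademacherPhi H' = (d - m) / q - normDedekindSum d q := by
    rw [rademacherPhi_of_pos (M := H') hq]
    change ((-m : ℤ) + (d : ℤ) : ℝ) / q - normDedekindSum d q = _
    push_cast
    ring
  -- Passing to B⁻¹S and B'⁻¹S moves t to the lower left corner. Then Φ(E) = 0, and q Φ(N) is the
  -- number λ of the form defining Λ_q.
  let E : SpecialLinearGroup (Fin 2) ℤ :=
    ⟨!![-(q * v), -n; t, q * v], by rw [det_fin_two_of]; linarith⟩
  let N : SpecialLinearGroup (Fin 2) ℤ :=
    ⟨!![-v, -n; t, q * (q * v)], by rw [det_fin_two_of]; linarith⟩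
  have hE : E = B⁻¹ * S := by
    have hBi : ((B⁻¹ : SpecialLinearGroup (Fin 2) ℤ) : Matrix (Fin 2) (Fin 2) ℤ)
        = !![n, -(q * v); -(q * v), t] := by rw [SL2_inv_expl]; rfl
    ext i j
    rw [coe_mul B⁻¹, coe_S, hBi]
    change !![-(q * v), -n; t, q * v] i j = (!![n, -(q * v); -(q * v), t]
      * !![0, -1; 1, 0] : Matrix (Fin 2) (Fin 2) ℤ) i j
    fin_cases i <;> fin_cases j <;> simp [Matrix.mul_apply, Fin.sum_univ_two]
  have hN : N = B'⁻¹ * S := by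
    have hBi : ((B'⁻¹ : SpecialLinearGroup (Fin 2) ℤ) : Matrix (Fin 2) (Fin 2) ℤ)
        = !![n, -v; -(q * (q * v)), t] := by rw [SL2_inv_expl]; rfl
    ext i j
    rw [coe_mul B'⁻¹, coe_S, hBi]
    change !![-v, -n; t, q * (q * v)] i j = (!![n, -v; -(q * (q * v)), t]
      * !![0, -1; 1, 0] : Matrix (Fin 2) (Fin 2) ℤ) i j
    fin_cases i <;> fin_cases j <;> simp [Matrix.mul_apply, Fin.sum_univ_two]
  have phiE : rademacherPhi E = 0 := by
    rw [rademacherPhi_of_pos (M := E) ht]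
    change ((-(q * v) : ℤ) + (q * v : ℤ) : ℝ) / t - normDedekindSum (q * v) t = _
    rw [normDedekindSum_eq_zero_of_dvd_sq_add_one ht ⟨n, htn.symm⟩]
    push_cast
    ring
  have phiN : rademacherPhi N = (-v + q * (q * v)) / t - normDedekindSum (q * v * q) t := by
    rw [rademacherPhi_of_pos (M := N) ht]
    change ((-v : ℤ) + (q * (q * v) : ℤ) : ℝ) / t - normDedekindSum (q * (q * v)) t = _
    rw [mul_comm (q * v) q]
    push_cast
    ring
  -- The two sign corrections from `S` coincide because q > 0.
  have phiB : rademacherPhi B' - rademacherPhi B = -rademacherPhi N := by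
    have s := cB.inv.rademacherPhi_mul_sub hq cB
    have x1 := rademacherPhi_mul_S B⁻¹
    have x2 := rademacherPhi_mul_S B'⁻¹
    rw [← hE, phiE] at x1
    rw [← hN] at x2
    have c1 : B'⁻¹ 1 0 = q * B⁻¹ 1 0 := cB.inv.2.2.1
    have c2 : B'⁻¹ 1 1 = B⁻¹ 1 1 := cB.inv.2.2.2
    rw [c1, c2, mul_assoc, Int.sign_mul, Int.sign_eq_one_of_pos hq, one_mul] at x2
    rw [rademacherPhi_inv] at x1 x2
    linarith
  refine ⟨ht'pos, ?_, ?_⟩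
  · have := SL2_row_one_isCoprime (A' * (B' * H'⁻¹))
    rwa [g3, g4, f10, f11] at this
  · rw [phiF, phiF', phiA, e2, phiB, phiN, rademacherPhi_inv, rademacherPhi_inv, phiH, phiH'] at e1
    field_simp at e1 ⊢
    linear_combination -e1

/-! ### Values k/q of S and the set Λ_q -/

/-- Reciprocity with denominators cleared, read modulo b; |a| S(b,|a|) is an integer. -/
theorem dvd_mul_sub_sq_add_one {a b n : ℤ} (hb : 0 < b) (h : IsCoprime a b)
    (hn : (n : ℝ) = b * normDedekindSum a b) : b ∣ a * n - (a ^ 2 + 1) := by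
  by_cases ha : a = 0
  · subst ha
    exact (isCoprime_zero_left.mp h).dvd
  · obtain ⟨c, hc, -⟩ := exists_int_eq_mul_normDedekindSum (a := b) (b := |a|)
      (abs_pos.mpr ha) (by
        rw [← Int.isCoprime_iff_gcd_eq_one]
        exact h.symm.abs_right)
    have e := normDedekindSum_reciprocity_int ha hb.ne' h
    rw [abs_of_pos hb, Int.sign_mul, Int.sign_eq_one_of_pos hb, mul_one] at e
    have har : (a : ℝ) ≠ 0 := by exact_mod_cast ha
    have hbr : (b : ℝ) ≠ 0 := by exact_mod_cast hb.ne'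
    have hs : (a : ℝ) * a.sign = |(a : ℝ)| := by
      have := Int.mul_sign_self a
      have h2 : ((a * a.sign : ℤ) : ℝ) = ((a.natAbs : ℤ) : ℝ) := by rw [this]
      rw [← Int.abs_eq_natAbs] at h2
      push_cast at h2
      exact h2
    push_cast at hc e
    have key : (a : ℝ) * n + b * c = a ^ 2 + b ^ 2 + 1 - 3 * |(a : ℝ)| * b := by
      rw [hn, hc, ← hs]
      field_simp at e
      linear_combination e
    refine ⟨b - 3 * |a| - c, ?_⟩
    have : ((a * n - (a ^ 2 + 1) : ℤ) : ℝ) = ((b * (b - 3 * |a| - c) : ℤ) : ℝ) := by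
      push_cast
      linear_combination key
    exact_mod_cast this

theorem normDedekindSum_eq_neg_of_mul_eq {q m d l : ℤ} (hq : 0 < q) (hl : q * l = -m * d - 1) :
    normDedekindSum m q = -normDedekindSum d q := by
  rw [← normDedekindSum_neg]
  exact normDedekindSum_eq_of_mul_modEq_one hq ⟨l, by linarith⟩

/-- `k / q` is a value of `S` exactly if `k - q S(k,q)` lies in `Λ_q` modulo `q² - 1`. -/
theorem exists_normDedekindSum_eq_iff {q : ℕ} (hq : 2 ≤ q) {k A : ℤ} (hk : Int.gcd k q = 1)
    (hA : (A : ℝ) = q * normDedekindSum k q) :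
    (∃ a b : ℤ, 1 ≤ b ∧ Int.gcd a b = 1 ∧ normDedekindSum a b = (k : ℝ) / (q : ℝ)) ↔
      ((k - A : ℤ) : ZMod (q ^ 2 - 1)) ∈ LambdaSet q := by
  have hq0 : (0 : ℤ) < q := by omega
  have hqr : (q : ℝ) ≠ 0 := by positivity
  have hkc : IsCoprime k (q : ℤ) := Int.isCoprime_iff_gcd_eq_one.mpr hk
  obtain ⟨d, l, hl⟩ : ∃ d l : ℤ, q * l = -k * d - 1 := by
    obtain ⟨u, v, huv⟩ := hkc
    exact ⟨-u, -v, by linarith⟩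
  have hSd := normDedekindSum_eq_neg_of_mul_eq hq0 hl
  have hpow : (((q ^ 2 - 1 : ℕ) : ℤ)) = (q : ℤ) ^ 2 - 1 := by
    rw [Nat.cast_sub (Nat.one_le_pow _ _ (by omega))]
    push_cast
    rfl
  constructor
  · rintro ⟨a, b, hb, hab, hS⟩
    have hb0 : 0 < b := by omega
    have habc : IsCoprime a b := Int.isCoprime_iff_gcd_eq_one.mpr hab
    obtain ⟨n, hn, -⟩ := exists_int_eq_mul_normDedekindSum hb0 hab
    have hnq : n * q = k * b := by
      have : ((n * q : ℤ) : ℝ) = ((k * b : ℤ) : ℝ) := by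
        push_cast
        rw [hn, hS]
        field_simp
      exact_mod_cast this
    obtain ⟨t, rfl⟩ : (q : ℤ) ∣ b := hkc.symm.dvd_of_dvd_mul_left ⟨n, by linarith⟩
    have ht0 : 0 < t := (mul_pos_iff_of_pos_left hq0).mp hb0
    have hnk : n = k * t := mul_right_cancel₀ hq0.ne' (by linarith)
    obtain ⟨z, hz⟩ := dvd_mul_sub_sq_add_one hb0 habc hn
    rw [hnk] at hz
    set n' : ℤ := a * k - q * z with hn'
    have htn' : t * n' = a ^ 2 + 1 := by rw [hn']; linear_combination hz
    -- These choices of t0, v, n0 invert the substitution of `normDedekindSum_mul_eq_add` with m =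
    -- k; `e1` and `e2` confirm that it returns t and a.
    obtain ⟨t0, ht0def⟩ : ∃ t0, t0 = n' - 2 * k * a + k ^ 2 * t := ⟨_, rfl⟩
    obtain ⟨v, hv⟩ : (q : ℤ) ∣ k * t - a + d * t0 := by
      refine ⟨-l * (k * t - a) - d * z, ?_⟩
      rw [ht0def, hn']
      linear_combination (k * t - a) * hl
    obtain ⟨n0, hn0⟩ : ∃ n0, n0 = t + 2 * d * (k * t - a) + d ^ 2 * t0 := ⟨_, rfl⟩
    have htt0 : t * t0 = (k * t - a) ^ 2 + 1 := by rw [ht0def]; linear_combination htn'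
    have ht0pos : 0 < t0 := by
      have : 0 < t * t0 := by rw [htt0]; positivity
      exact (mul_pos_iff_of_pos_left ht0).mp this
    have htn0 : t0 * n0 = (q * v) ^ 2 + 1 := by
      rw [hn0, ← hv]
      linear_combination htt0
    obtain ⟨-, -, hkey⟩ := normDedekindSum_mul_eq_add hq0 ht0pos htn0 hl
    have e1 : n0 - 2 * d * (q * v) + d ^ 2 * t0 = t := by rw [hn0, ← hv]; ring
    have e2 : d * t0 - q * v + k * t = a := by rw [← hv]; ring
    rw [e1, e2, hS] at hkey
    refine ⟨q * v, t0, k - A - d * (1 - q ^ 2), ht0pos, ⟨n0, htn0.symm⟩, ?_, ?_, ?_⟩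
    · rw [← Int.isCoprime_iff_gcd_eq_one]
      have hc : IsCoprime ((q : ℤ) * v) t0 := ⟨-(q * v), n0, by linear_combination htn0⟩
      exact hc.mul_left (IsCoprime.of_mul_left_left hc)
    · push_cast
      push_cast at hkey
      rw [hSd] at hA
      rw [mul_div_cancel₀ _ hqr] at hkey
      rw [hA]
      linear_combination hkey
    · rw [ZMod.intCast_eq_intCast_iff_dvd_sub, hpow]
      exact ⟨d, by ring⟩
  · rintro ⟨a, t, n, ht, hta, hg, hn, hx⟩
    rw [ZMod.intCast_eq_intCast_iff_dvd_sub, hpow] at hx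
    obtain ⟨s, hs⟩ := hx
    -- Shifting a by a multiple of t changes λ by a multiple of q² - 1, which turns the congruence
    -- into an equality.
    obtain ⟨w, hw⟩ : ∃ w, w = a + t * (d - s) := ⟨_, rfl⟩
    have htr : (t : ℝ) ≠ 0 := by exact_mod_cast ht.ne'
    have htw : t ∣ w ^ 2 + 1 := by
      have : w ^ 2 + 1 = (a ^ 2 + 1) + t * ((d - s) * (2 * a + t * (d - s))) := by rw [hw]; ring
      rw [this]
      exact dvd_add hta (dvd_mul_right _ _)
    have hac : IsCoprime (a * q) t := Int.isCoprime_iff_gcd_eq_one.mpr hg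
    have hwt : IsCoprime (w * q) t := by
      have : w * q = a * q + t * ((d - s) * q) := by rw [hw]; ring
      rw [this]
      exact hac.add_mul_left_left _
    have hSw : normDedekindSum (w * q) t = normDedekindSum (a * q) t :=
      normDedekindSum_congr ht.ne' ⟨-((d - s) * q), by rw [hw]; ring⟩
    have hlam : ((k - A - d * (1 - q ^ 2) : ℤ) : ℝ)
        = ((q : ℝ) ^ 2 - 1) * w / t - q * normDedekindSum (w * q) t := by
      have e : k - A - d * (1 - q ^ 2) = n + (q ^ 2 - 1) * (d - s) := by linear_combination -hs
      rw [e, hSw, hw]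
      push_cast
      rw [hn]
      field_simp
      ring
    obtain ⟨c, hc, -⟩ := exists_int_eq_mul_normDedekindSum ht (Int.isCoprime_iff_gcd_eq_one.mp hwt)
    -- Modulo q, w ≡ -t(k - A - d). Multiplying by k and using kd ≡ -1 and kA ≡ k² + 1 gives kw ≡ 0.
    have hdw : (q : ℤ) ∣ w := by
      have h1 : t * (k - A - d * (1 - q ^ 2)) = (q ^ 2 - 1) * w - q * c := by
        have : ((t * (k - A - d * (1 - q ^ 2)) : ℤ) : ℝ) = (((q ^ 2 - 1) * w - q * c : ℤ) : ℝ) := by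
          rw [Int.cast_mul, hlam]
          push_cast
          rw [hc]
          field_simp
        exact_mod_cast this
      obtain ⟨y, hy⟩ := dvd_mul_sub_sq_add_one hq0 hkc (by exact_mod_cast hA)
      have h2 : (q : ℤ) ∣ k * w := by
        refine ⟨k * q * w - k * c - t * (-y + l + k * d * q), ?_⟩
        linear_combination k * h1 + t * hy + t * hl
      exact hkc.symm.dvd_of_dvd_mul_left h2
    obtain ⟨v, rfl⟩ := hdw
    obtain ⟨n0, hn0⟩ := htw
    obtain ⟨hpos, hcop, hkey⟩ := normDedekindSum_mul_eq_add hq0 ht hn0.symm hl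
    refine ⟨_, _, ?_, Int.isCoprime_iff_gcd_eq_one.mp hcop.symm, ?_⟩
    · have := mul_pos hq0 hpos
      omega
    · rw [eq_div_iff hqr, mul_comm]
      refine Eq.trans hkey ?_
      rw [hSd] at hA
      push_cast at hlam ⊢
      linear_combination -hlam - hA

/-! ### Dedekind sums and the Jacobi symbol modulo 8 -/

theorem natCast_zmod_eight_of_odd {r : ℕ} (hr : Odd r) :
    (r % 4 = 1 ∧ ((r : ZMod 8) = 1 ∨ (r : ZMod 8) = 5)) ∨
    (r % 4 = 3 ∧ ((r : ZMod 8) = 3 ∨ (r : ZMod 8) = 7)) := by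
  rw [Nat.odd_iff] at hr
  have h : ∀ i : ℕ, r % 8 = i % 8 → (r : ZMod 8) = (i : ZMod 8) :=
    fun i hi => (ZMod.natCast_eq_natCast_iff' r i 8).mpr hi
  have hc : r % 8 = 1 ∨ r % 8 = 3 ∨ r % 8 = 5 ∨ r % 8 = 7 := by omega
  rcases hc with hc | hc | hc | hc
  · exact Or.inl ⟨by omega, Or.inl (by exact_mod_cast h 1 hc)⟩
  · exact Or.inr ⟨by omega, Or.inl (by exact_mod_cast h 3 hc)⟩
  · exact Or.inl ⟨by omega, Or.inr (by exact_mod_cast h 5 hc)⟩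
  · exact Or.inr ⟨by omega, Or.inr (by exact_mod_cast h 7 hc)⟩

/-- Dedekind reciprocity modulo 8 matches quadratic reciprocity; this is the Euclidean step that
exchanges r and k. What remains is a finite check over odd residues. -/
theorem zmod_eight_eq_of_reciprocity {r k : ℕ} (hr : Odd r) (hk : Odd k) (h : r.Coprime k)
    {A B : ℤ} (hAB : r * A + k * B = r ^ 2 + k ^ 2 + 1 - 3 * r * k)
    (hB : (B : ZMod 8) = r + 1 - 2 * (jacobiSym k r : ℤ)) :
    (A : ZMod 8) = k + 1 - 2 * (jacobiSym r k : ℤ) := by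
  have h8 := congrArg (Int.cast : ℤ → ZMod 8) hAB
  push_cast at h8
  rw [hB] at h8
  have hJ : jacobiSym k r = 1 ∨ jacobiSym k r = -1 :=
    jacobiSym.eq_one_or_neg_one (by exact_mod_cast h.symm)
  generalize (A : ZMod 8) = a at h8 ⊢
  rcases natCast_zmod_eight_of_odd hr with ⟨hr4, hr8⟩ | ⟨hr4, hr8⟩
  · rw [jacobiSym.quadratic_reciprocity_one_mod_four hr4 hk]
    rcases natCast_zmod_eight_of_odd hk with ⟨-, hk8⟩ | ⟨-, hk8⟩ <;>
    rcases hJ with hJ | hJ <;> rcases hr8 with hr8 | hr8 <;> rcases hk8 with hk8 | hk8 <;>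
    rw [hJ, hr8, hk8] at h8 <;> rw [hJ, hk8] <;> revert a <;> decide
  · rcases natCast_zmod_eight_of_odd hk with ⟨hk4, hk8⟩ | ⟨hk4, hk8⟩
    · rw [← jacobiSym.quadratic_reciprocity_one_mod_four hk4 hr]
      rcases hJ with hJ | hJ <;> rcases hr8 with hr8 | hr8 <;> rcases hk8 with hk8 | hk8 <;>
      rw [hJ, hr8, hk8] at h8 <;> rw [hJ, hk8] <;> revert a <;> decide
    · rw [jacobiSym.quadratic_reciprocity_three_mod_four hr4 hk4]
      rcases hJ with hJ | hJ <;> rcases hr8 with hr8 | hr8 <;> rcases hk8 with hk8 | hk8 <;>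
      rw [hJ, hr8, hk8] at h8 <;> rw [hJ, hk8] <;> revert a <;> decide

/-- The congruence of Dedekind sums with the Jacobi symbol modulo `8`. -/
theorem mul_normDedekindSum_zmod_eight {k : ℕ} (hk : Odd k) {h A : ℤ} (hc : Int.gcd h k = 1)
    (hA : (A : ℝ) = k * normDedekindSum h k) :
    (A : ZMod 8) = k + 1 - 2 * (jacobiSym h k : ℤ) := by
  induction k using Nat.strong_induction_on generalizing h A with
  | _ k ih =>
  have hk0 : 0 < k := hk.pos
  have hkz : (k : ℤ) ≠ 0 := by positivity
  rcases Nat.eq_or_lt_of_le (Nat.one_le_iff_ne_zero.mpr hk0.ne') with rfl | hk1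
  · rw [Nat.cast_one, Nat.cast_one, normDedekindSum_one] at hA
    have : A = 0 := by exact_mod_cast hA.trans (mul_zero _)
    rw [this, jacobiSym.one_right]
    decide
  have core : ∀ (r : ℕ) (A : ℤ), 0 < r → r < k → Odd r → r.Coprime k →
      (A : ℝ) = k * normDedekindSum r k → (A : ZMod 8) = k + 1 - 2 * (jacobiSym r k : ℤ) := by
    intro r A hr0 hrk hr hrc hA
    have hg : Int.gcd k r = 1 := by exact_mod_cast hrc.symm
    obtain ⟨B, hB, -⟩ := exists_int_eq_mul_normDedekindSum (a := k) (b := r)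
      (by exact_mod_cast hr0) hg
    refine zmod_eight_eq_of_reciprocity hr hk hrc (B := B) ?_ (ih r hrk hr hg (by exact_mod_cast hB))
    have := normDedekindSum_reciprocity hr0 hk0 hrc
    have h2 : ((r * A + k * B : ℤ) : ℝ) = ((r ^ 2 + k ^ 2 + 1 - 3 * r * k : ℤ) : ℝ) := by
      push_cast at hB ⊢
      rw [hA, hB]
      linear_combination this
    exact_mod_cast h2
  obtain ⟨r, hr⟩ := Int.eq_ofNat_of_zero_le (Int.emod_nonneg h hkz)
  have hrk : r < k := by
    have := Int.emod_lt_of_pos h (b := k) (by omega)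
    omega
  have hrc : r.Coprime k := by
    have h1 : Int.gcd (h % k) k = 1 := by rwa [Int.gcd_emod]
    rw [hr] at h1
    exact_mod_cast h1
  have hr0 : 0 < r := by
    rcases Nat.eq_zero_or_pos r with rfl | h0
    · rw [Nat.coprime_zero_left] at hrc
      omega
    · exact h0
  have hS : normDedekindSum h k = normDedekindSum r k := by
    apply normDedekindSum_congr hkz
    have h1 : (r : ℤ) = h % k := hr.symm
    rw [h1]
    exact ⟨-(h / k), by linarith [Int.emod_add_mul_ediv h k]⟩
  have hJ : jacobiSym h k = jacobiSym r k := by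
    rw [jacobiSym.mod_left h k, hr]
  rw [hS] at hA
  rw [hJ]
  -- The exchange step needs an odd remainder. As k is odd, an even r is replaced by k - r, which
  -- negates S and multiplies the symbol by (-1/k).
  rcases Nat.even_or_odd r with he | ho
  · have hr' : ((k - r : ℕ) : ℤ) = -r + k * 1 := by omega
    have hc' : (k - r).Coprime k := by
      rw [← Nat.isCoprime_iff_coprime, hr']
      exact (Nat.isCoprime_iff_coprime.mpr hrc).neg_left.add_mul_left_left 1
    have e := core (k - r) (-A) (by omega) (by omega) (Nat.Odd.sub_even hrk.le hk he) hc' (by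
      rw [hr', normDedekindSum_add_mul _ _ _ hkz, normDedekindSum_neg]
      push_cast
      rw [hA]
      ring)
    have hJ2 : jacobiSym (k - r : ℕ) k = jacobiSym (-r) k := by
      rw [jacobiSym.mod_left, hr', Int.add_mul_emod_self_left, ← jacobiSym.mod_left]
    have hJ3 : jacobiSym r k = 1 ∨ jacobiSym r k = -1 :=
      jacobiSym.eq_one_or_neg_one (by exact_mod_cast hrc)
    rw [hJ2, jacobiSym.neg _ hk] at e
    push_cast at e
    generalize (A : ZMod 8) = a at e ⊢
    rcases natCast_zmod_eight_of_odd hk with ⟨hk4, hk8⟩ | ⟨hk4, hk8⟩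
    · rw [ZMod.χ₄_nat_one_mod_four hk4] at e
      rcases hJ3 with hJ3 | hJ3 <;> rcases hk8 with hk8 | hk8 <;> rw [hJ3, hk8] at e <;>
      rw [hJ3, hk8] <;> revert a <;> decide
    · rw [ZMod.χ₄_nat_three_mod_four hk4] at e
      rcases hJ3 with hJ3 | hJ3 <;> rcases hk8 with hk8 | hk8 <;> rw [hJ3, hk8] at e <;>
      rw [hJ3, hk8] <;> revert a <;> decide
  · exact core r A hr0 hrk ho hrc hA

/-! ### The set Γ_q and the local conditions -/

theorem exists_intCast_eq_mul_iff {M c : ℕ} {x : ℤ} :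
    (∃ s : ZMod M, (x : ZMod M) = (c : ZMod M) * s) ↔ (Nat.gcd c M : ℤ) ∣ x := by
  constructor
  · rintro ⟨s, hs⟩
    obtain ⟨z, rfl⟩ := ZMod.intCast_surjective s
    have h : ((x : ℤ) : ZMod M) = ((c * z : ℤ) : ZMod M) := by rw [hs]; push_cast; rfl
    rw [ZMod.intCast_eq_intCast_iff_dvd_sub] at h
    have h1 : (Nat.gcd c M : ℤ) ∣ c := by exact_mod_cast Nat.gcd_dvd_left c M
    have h2 : (Nat.gcd c M : ℤ) ∣ M := by exact_mod_cast Nat.gcd_dvd_right c M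
    have := dvd_sub (h1.mul_right z) (h2.trans h)
    rwa [sub_sub_cancel] at this
  · rintro ⟨z, hz⟩
    refine ⟨((Nat.gcdA c M * z : ℤ) : ZMod M), ?_⟩
    rw [hz, Nat.gcd_eq_gcd_ab]
    push_cast
    rw [ZMod.natCast_self]
    ring

/-- Only q modulo 24 matters; 23 stands for -1, avoiding truncated subtraction. -/
theorem gcd_sq_sub_one {q c : ℕ} (hq : 2 ≤ q) (hc : c ∣ 24) :
    Nat.gcd c (q ^ 2 - 1) = Nat.gcd c ((q % 24) ^ 2 + 23) := by
  have h : q ^ 2 - 1 ≡ (q % 24) ^ 2 + 23 [MOD 24] := by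
    have h1 : q ^ 2 - 1 + 24 ≡ (q % 24) ^ 2 + 23 [MOD 24] := by
      have h2 : q ^ 2 - 1 + 24 = q ^ 2 + 23 := by
        have := Nat.one_le_pow 2 q (by omega)
        omega
      rw [h2]
      exact ((Nat.mod_modEq q 24).symm.pow 2).add_right 23
    exact (Nat.ModEq.symm (by simp [Nat.ModEq])).trans h1
  rw [Nat.gcd_comm, (h.of_dvd hc).gcd_eq, Nat.gcd_comm]

theorem mem_GammaSet_iff_localConditions {q : ℕ} (hq : 2 ≤ q) {k A : ℤ} (hk : Int.gcd k q = 1)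
    (hA : (A : ℝ) = q * normDedekindSum k q) :
    ((k - A : ℤ) : ZMod (q ^ 2 - 1)) ∈ GammaSet q ↔ LocalConditions q k := by
  have h3 : ¬ 3 ∣ q → 3 ∣ A := by
    obtain ⟨n, hn, hn3⟩ := exists_int_eq_mul_normDedekindSum (a := k) (b := q) (by omega) hk
    have : A = n := by
      have : (A : ℝ) = n := by rw [hA, hn]; push_cast; rfl
      exact_mod_cast this
    rw [this]
    exact fun h => hn3 (by omega)
  -- The alternatives are the Jacobi symbol values 1 and -1; for a square q the symbol is itself a
  -- square, hence 1.
  have h8 : q % 2 = 1 → (A - (q - 1)) % 8 = 0 ∨ (A - (q + 3)) % 8 = 0 ∧ ¬ IsSquare q := by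
    intro ho
    have e := mul_normDedekindSum_zmod_eight (Nat.odd_iff.mpr ho) hk hA
    have e' : ((A - (q + 1 - 2 * jacobiSym k q) : ℤ) : ZMod 8) = 0 := by
      push_cast
      rw [e]
      ring
    have e'' := (ZMod.intCast_zmod_eq_zero_iff_dvd _ 8).mp e'
    rcases jacobiSym.eq_one_or_neg_one (b := q) hk with hJ | hJ
    · rw [hJ] at e''
      left; omega
    · rw [hJ] at e''
      refine Or.inr ⟨by omega, ?_⟩
      rintro ⟨r, rfl⟩
      rw [jacobiSym.mul_right'] at hJ
      · nlinarith [mul_self_nonneg (jacobiSym k r)]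
      all_goals
        rintro rfl
        omega
  have hsq : IsSquare q → q % 2 = 1 → q % 8 = 1 := by
    rintro ⟨r, rfl⟩ ho
    have hr : r % 8 = 1 ∨ r % 8 = 3 ∨ r % 8 = 5 ∨ r % 8 = 7 := by
      have : r % 2 = 1 := by
        rcases Nat.mod_two_eq_zero_or_one r with h | h
        · rw [Nat.mul_mod, h] at ho; omega
        · exact h
      omega
    rw [Nat.mul_mod]
    rcases hr with h | h | h | h <;> rw [h]
  have hG : ((k - A : ℤ) : ZMod (q ^ 2 - 1)) ∈ GammaSet q ↔
      (IsSquare q → (Nat.gcd 24 (q ^ 2 - 1) : ℤ) ∣ k - A) ∧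
      (¬ IsSquare q → (Nat.gcd 12 (q ^ 2 - 1) : ℤ) ∣ k - A) := by
    unfold GammaSet
    rw [← exists_intCast_eq_mul_iff, ← exists_intCast_eq_mul_iff]
    push_cast
    rfl
  rw [hG, gcd_sq_sub_one hq (by norm_num), gcd_sq_sub_one hq (by norm_num)]
  unfold LocalConditions Nat.ModEq Int.ModEq
  have hgcd : ∀ r : ℕ, r < 24 →
      (r % 2 = 1 ∧ r % 3 ≠ 0 ∧ Nat.gcd 24 (r ^ 2 + 23) = 24 ∧ Nat.gcd 12 (r ^ 2 + 23) = 12) ∨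
      (r % 2 = 1 ∧ r % 3 = 0 ∧ Nat.gcd 24 (r ^ 2 + 23) = 8 ∧ Nat.gcd 12 (r ^ 2 + 23) = 4) ∨
      (r % 2 = 0 ∧ r % 3 ≠ 0 ∧ Nat.gcd 24 (r ^ 2 + 23) = 3 ∧ Nat.gcd 12 (r ^ 2 + 23) = 3) ∨
      (r % 2 = 0 ∧ r % 3 = 0 ∧ Nat.gcd 24 (r ^ 2 + 23) = 1 ∧ Nat.gcd 12 (r ^ 2 + 23) = 1) := by
    decide
  have hg := hgcd (q % 24) (Nat.mod_lt _ (by norm_num))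
  rw [Nat.mod_mod_of_dvd q (by norm_num : 2 ∣ 24), Nat.mod_mod_of_dvd q (by norm_num : 3 ∣ 24)] at hg
  by_cases hs : IsSquare q
  · have hsq' := hsq hs
    simp only [hs, not_true_eq_false, forall_true_left, false_imp_iff, and_true, and_false,
      or_false, imp_true_iff] at h8 ⊢
    rcases hg with ⟨h2, h3', g1, g2⟩ | ⟨h2, h3', g1, g2⟩ | ⟨h2, h3', g1, g2⟩ | ⟨h2, h3', g1, g2⟩ <;>
    rw [g1] <;> clear g1 g2 <;> omega
  · simp only [hs, not_false_eq_true, false_imp_iff, true_and, and_true, true_imp_iff] at h8 ⊢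
    rcases hg with ⟨h2, h3', g1, g2⟩ | ⟨h2, h3', g1, g2⟩ | ⟨h2, h3', g1, g2⟩ | ⟨h2, h3', g1, g2⟩ <;>
    rw [g2] <;> clear g1 g2 <;> omega

theorem mainTheorem2 (q : ℕ) (hq : 2 ≤ q) (hconj : LambdaSet q = GammaSet q) :
    ∀ k : ℤ, Int.gcd k q = 1 →
      ((∃ a b : ℤ, 1 ≤ b ∧ Int.gcd a b = 1 ∧ normDedekindSum a b = (k : ℝ) / (q : ℝ)) ↔
        LocalConditions q k) := by
  intro k hk
  obtain ⟨A, hA, -⟩ := exists_int_eq_mul_normDedekindSum (a := k) (b := q) (by omega) hk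
  rw [Int.cast_natCast] at hA
  rw [exists_normDedekindSum_eq_iff hq hk hA, hconj, mem_GammaSet_iff_localConditions hq hk hA]
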